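/- Let $G$ be a finite connected simple graph that is not complete. Let $(\{P_v\}_{v\in V(G)},T)$ be a clique NC-path-tree model of $G$. This means: $T$ is a tree; each $P_v$ is a path in $T$ (possibly a single node), and $T$ is the union of these paths; distinct $u,v$ are adjacent in $G$ if and only if $P_u\cap P_v\neq\emptyset$; for all $u,v$ both $P_u\setminus P_v$ and $P_v\setminus P_u$ are connected (or empty); and, with $G_x=\{v : x\in P_v\}$, the map $x\mapsto G_x$ is a bijection from the nodes of $T$ to the maximal cliques of $G$. A node $x$ of $T$ is a *terminal* if it is a leaf of every $P_v$ containing it (the node of a one-node path counts as a leaf), and a *junction* if it is an internal node of every $P_v$ containing it. A *minimum connected dominating set* (MCDS) of $G$ is a set $D\subseteq V(G)$ with the fewest vertices such that every vertex of $G$ is in $D$ or has a neighbor in $D$ and $G[D]$ is connected. Two distinct vertices are *twins* if they have the same closed neighborhood. Then a set $D\subseteq V(G)$ is an MCDS of $G$ if and only if $D$ satisfies the following three conditions and contains no vertices other than those they describe, that is, every vertex of $D$ belongs to one of the sets $G_x$ in (1), $G_x\cap G_y$ in (2), or $\bigcup_{i=2}^{k-1}G_{z_i}$ in (3). 1. For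 each junction $x$ of $T$, $D$ contains exactly two vertices $u,v$ of $G_x$; $P_u\cup P_v$ contains all neighbors of $x$ in $T$, and $u,v$ are not twins. 2. For each edge $xy$ of $T$ where both $x$ and $y$ are terminals, $D$ contains exactly one vertex of $G_x\cap G_y$. 3. For each path $(z_1,\dots,z_k)$ in $T$ with $k\ge 3$ where $z_1,z_k$ are terminals and $z_2,\dots,z_{k-1}$ have degree $2$ in $T$, the set $D\cap\bigcup_{i=2}^{k-1}G_{z_i}$ is, for each $u\in G_{z_1}\setminus G_{z_2}$ and each $v\in G_{z_k}\setminus G_{z_{k-1}}$, the set of inner vertices of a shortest $(u,v)$-path of $G$. -/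

import Mathlib

namespace NCPathTree

/-! ### Graph notions -/

section Graphs

variable {V : Type*}

/-- The inner vertices of a path, given as a walk `p`: all its vertices except the two ends. -/
def innerVerts {G : SimpleGraph V} {u v : V} (p : G.Walk u v) : Set V :=
  {w | w ∈ p.support ∧ w ≠ u ∧ w ≠ v}

/-- `p` is a shortest `(u,v)`-path of `G`. -/
def IsShortestPath (G : SimpleGraph V) {u v : V} (p : G.Walk u v) : Prop :=
  p.IsPath ∧ p.length = G.dist u v

/-- Twins: distinct vertices with the same closed neighborhood. -/
def Twins (G : SimpleGraph V) (u v : V) : Prop :=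
  u ≠ v ∧ insert u (G.neighborSet u) = insert v (G.neighborSet v)

/-- Every vertex is in `D` or adjacent to a vertex of `D`. -/
def IsDominating (G : SimpleGraph V) (D : Set V) : Prop :=
  ∀ v, v ∈ D ∨ ∃ w ∈ D, G.Adj v w

/-- A dominating set that induces a connected subgraph. -/
def IsConnectedDominating (G : SimpleGraph V) (D : Set V) : Prop :=
  IsDominating G D ∧ (G.induce D).Connected

/-- A minimum connected dominating set: a connected dominating set with the fewest vertices
(used for finite graphs). -/
def IsMCDS (G : SimpleGraph V) (D : Set V) : Prop :=
  IsConnectedDominating G D ∧ ∀ D' : Set V, IsConnectedDominating G D' → D.ncard ≤ D'.ncard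

end Graphs

/-! ### Models by non-crossing paths in a tree

A path in the host tree `T` is given by its node set; as `T` is a tree, the path is the subgraph
of `T` induced by this set, and its edges are the edges of `T` with both ends in the set. -/

section Models

variable {V X : Type*}

/-- `S` is the node set of a path of `T` (possibly with a single node). -/
def IsPathSet (T : SimpleGraph X) (S : Set X) : Prop :=
  ∃ (x y : X) (p : T.Walk x y), p.IsPath ∧ S = {z | z ∈ p.support}

/-- `S₁` and `S₂` are non-crossing: `S₁ \ S₂` and `S₂ \ S₁` are both connected
(the empty set counts as connected). -/
def NonCrossing (T : SimpleGraph X) (S₁ S₂ : Set X) : Prop :=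
  (T.induce (S₁ \ S₂)).Preconnected ∧ (T.induce (S₂ \ S₁)).Preconnected

/-- `G_x`: the set of vertices whose guest contains the node `x`. -/
def bag (P : V → Set X) (x : X) : Set V := {v | x ∈ P v}

/-- `({P_v}, T)` is an NC-path-tree model of `G`. -/
structure IsNCPathTreeModel (G : SimpleGraph V) (T : SimpleGraph X) (P : V → Set X) : Prop where
  isTree : T.IsTree
  isPath : ∀ v, IsPathSet T (P v)
  node_covered : ∀ x, ∃ v, x ∈ P v
  edge_covered : ∀ x y, T.Adj x y → ∃ v, x ∈ P v ∧ y ∈ P v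
  adj_iff : ∀ u v, u ≠ v → (G.Adj u v ↔ (P u ∩ P v).Nonempty)
  nonCrossing : ∀ u v, NonCrossing T (P u) (P v)

/-- A clique NC-path-tree model: moreover `x ↦ G_x` is a bijection from the nodes of `T` onto the
maximal cliques of `G`, i.e. `T` is a clique tree of `G`. -/
structure IsCliqueNCPathTreeModel (G : SimpleGraph V) (T : SimpleGraph X) (P : V → Set X) : Prop
    extends IsNCPathTreeModel G T P where
  bag_injective : Function.Injective (bag P)
  range_bag : Set.range (bag P) = {K | Maximal G.IsClique K}

/-- `x` is an internal node of the path with node set `S`: it lies on the path and has two distinct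
neighbors on it. The other nodes of the path are its leaves. -/
def IsInternal (T : SimpleGraph X) (S : Set X) (x : X) : Prop :=
  x ∈ S ∧ ∃ y ∈ S, ∃ z ∈ S, y ≠ z ∧ T.Adj x y ∧ T.Adj x z

/-- `x` is a leaf of the path with node set `S`; the node of a one-node path is a leaf. -/
def IsLeaf (T : SimpleGraph X) (S : Set X) (x : X) : Prop :=
  x ∈ S ∧ ¬ IsInternal T S x

/-- A terminal is a leaf of every path that contains it. -/
def IsTerminal (T : SimpleGraph X) (P : V → Set X) (x : X) : Prop :=
  ∀ v, x ∈ P v → IsLeaf T (P v) x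

/-- A junction is an internal node of every path that contains it. -/
def IsJunction (T : SimpleGraph X) (P : V → Set X) (x : X) : Prop :=
  ∀ v, x ∈ P v → IsInternal T (P v) x

/-- The walk `p = (z₁, …, z_k)` is a path of `T` with `k ≥ 3` whose two end nodes are terminals and
whose inner nodes all have degree two in `T`. -/
def IsTerminalPath (T : SimpleGraph X) (P : V → Set X) {a b : X} (p : T.Walk a b) : Prop :=
  p.IsPath ∧ 2 ≤ p.length ∧ IsTerminal T P a ∧ IsTerminal T P b ∧
    ∀ z ∈ innerVerts p, (T.neighborSet z).ncard = 2

/-- The union of the sets `G_z` over the inner nodes `z` of `p`. -/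
def innerBags {T : SimpleGraph X} (P : V → Set X) {a b : X} (p : T.Walk a b) : Set V :=
  {v | ∃ z ∈ innerVerts p, v ∈ bag P z}

/-! ### The conditions on a vertex set `D` -/

/-- Every vertex of `D` is one of those that the three conditions below speak about. -/
def OnlyListed (T : SimpleGraph X) (P : V → Set X) (D : Set V) : Prop :=
  ∀ v ∈ D,
    (∃ x, IsJunction T P x ∧ v ∈ bag P x) ∨
    (∃ x y, T.Adj x y ∧ IsTerminal T P x ∧ IsTerminal T P y ∧ v ∈ bag P x ∩ bag P y) ∨
    (∃ (a b : X) (p : T.Walk a b), IsTerminalPath T P p ∧ v ∈ innerBags P p)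

/-- For each junction `x`, `D` contains exactly two vertices of `G_x`; their paths together contain
all neighbors of `x`, and they are not twins. -/
def JunctionCondition (G : SimpleGraph V) (T : SimpleGraph X) (P : V → Set X) (D : Set V) : Prop :=
  ∀ x, IsJunction T P x → ∃ u v, u ≠ v ∧ D ∩ bag P x = {u, v} ∧
    T.neighborSet x ⊆ P u ∪ P v ∧ ¬ Twins G u v

/-- For each edge `xy` of `T` between terminals, `D` contains exactly one vertex of `G_x ∩ G_y`. -/
def TerminalEdgeCondition (T : SimpleGraph X) (P : V → Set X) (D : Set V) : Prop :=
  ∀ x y, T.Adj x y → IsTerminal T P x → IsTerminal T P y → ∃! v, v ∈ D ∩ (bag P x ∩ bag P y)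

/-- For each path `(z₁, …, z_k)` of `T` as in `IsTerminalPath`, the members of `D` in
`G_{z₂} ∪ … ∪ G_{z_{k-1}}` are the inner vertices of a shortest path of `G` from `u` to `v`, for
each `u ∈ G_{z₁} \ G_{z₂}` and each `v ∈ G_{z_k} \ G_{z_{k-1}}`. -/
def TerminalPathCondition (G : SimpleGraph V) (T : SimpleGraph X) (P : V → Set X) (D : Set V) :
    Prop :=
  ∀ (a b : X) (p : T.Walk a b), IsTerminalPath T P p →
    ∀ u ∈ bag P a \ bag P p.snd, ∀ v ∈ bag P b \ bag P p.penultimate,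
      ∃ q : G.Walk u v, IsShortestPath G q ∧ innerVerts q = D ∩ innerBags P p

end Models

end NCPathTree

namespace NCPathTree

/-! ### Edges, sides and paths of a tree -/

section Trees

variable {X : Type*} {T : SimpleGraph X}

/-! The problem becomes one of covering the edges of `T`. By `isMCDS_iff`, the connected dominating
sets of `G` are exactly the sets of vertices whose guests cover every edge of `T`, so an MCDS is a
smallest edge cover by guests.

This covering problem splits into independent local ones. Non-crossing, together with the fact that
no bag contains another, is very restrictive at a nonterminal node: it has degree two or is a tripod
(`eq_or_isTripod`). Tripods are the same as junctions, and all their neighbors are terminals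
(`isTerminal_of_adj_isTripod`). Hence every edge of `T` lies in a block that is a star at a
junction, a single edge between terminals, or a terminal path (`edge_cases`), and a guest covering
an edge of a block covers no edge outside it.

The optimum on a block is two for a star, one for a terminal edge, and for a terminal path the
number of inner vertices of a shortest path of `G` between its two ends. Exchanging the members of a
cover on one block (`IsMinCover.ncard_inter_le`, `Covers.isMinCover`) shows that a cover is minimum
exactly when it is optimal on each block and has no other vertices. -/

/-- The nodes that stay connected to `x` when the edge `xy` is deleted. -/
def side (T : SimpleGraph X) (x y : X) : Set X :=
  {z | (T.deleteEdges {s(x, y)}).Reachable x z}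

theorem left_mem_side (x y : X) : x ∈ side T x y :=
  SimpleGraph.Reachable.refl x

theorem right_notMem_side (hT : T.IsAcyclic) {x y : X} (h : T.Adj x y) : y ∉ side T x y :=
  SimpleGraph.isBridge_iff.1 (SimpleGraph.isAcyclic_iff_forall_adj_isBridge.1 hT h)

/-- The only edge leaving a side is the deleted one. -/
theorem eq_of_adj_side (hT : T.IsAcyclic) {x y : X} (h : T.Adj x y) {c d : X}
    (hc : c ∈ side T x y) (hd : d ∉ side T x y) (hcd : T.Adj c d) : c = x ∧ d = y := by
  by_cases he : s(c, d) = s(x, y)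
  · rcases Sym2.eq_iff.1 he with h' | ⟨rfl, rfl⟩
    · exact h'
    · exact absurd hc (right_notMem_side hT h)
  · refine absurd (SimpleGraph.Reachable.trans hc (SimpleGraph.Adj.reachable ?_)) hd
    simp [SimpleGraph.deleteEdges_adj, hcd, he]

theorem neighbor_mem_side (hT : T.IsAcyclic) {x y z : X} (h : T.Adj x y) (hz : T.Adj x z)
    (hne : z ≠ y) : z ∈ side T x y := by
  by_contra hc
  exact hne (eq_of_adj_side hT h (left_mem_side x y) hc hz).2

/-- The side of `y` avoids the neighbors of `x` other than `y`. -/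
theorem neighbor_notMem_side (hT : T.IsAcyclic) {x y z : X} (h : T.Adj x y) (hz : T.Adj x z)
    (hne : z ≠ y) : z ∉ side T y x := by
  intro hc
  have := eq_of_adj_side hT h.symm hc (right_notMem_side hT h.symm) hz.symm
  exact hne this.1

theorem exists_crossing {S A : Set X} (hS : (T.induce S).Preconnected) {s t : X} (hs : s ∈ S)
    (ht : t ∈ S) (hsA : s ∈ A) (htA : t ∉ A) :
    ∃ c ∈ S, ∃ d ∈ S, c ∈ A ∧ d ∉ A ∧ T.Adj c d := by
  obtain ⟨w⟩ := hS ⟨s, hs⟩ ⟨t, ht⟩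
  obtain ⟨d, -, h1, h2⟩ := w.exists_boundary_dart (Subtype.val ⁻¹' A) hsA htA
  exact ⟨_, d.fst.2, _, d.snd.2, h1, h2, d.adj⟩

/-- The edge `xy` is the only passage between its sides. The later arguments about the position of
guests in the tree reduce to this. -/
theorem mem_of_meets_sides (hT : T.IsAcyclic) {S : Set X} (hS : (T.induce S).Preconnected)
    {x y : X} (h : T.Adj x y) {s t : X} (hs : s ∈ S) (ht : t ∈ S) (hs' : s ∈ side T x y)
    (ht' : t ∉ side T x y) : x ∈ S ∧ y ∈ S := by
  obtain ⟨c, hc, d, hd, h1, h2, h3⟩ := exists_crossing hS hs ht hs' ht'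
  obtain ⟨rfl, rfl⟩ := eq_of_adj_side hT h h1 h2 h3
  exact ⟨hc, hd⟩

theorem subset_side (hT : T.IsAcyclic) {S : Set X} (hS : (T.induce S).Preconnected)
    {x y : X} (h : T.Adj x y) {s : X} (hs : s ∈ S) (hs' : s ∈ side T x y)
    (hxy : ¬ (x ∈ S ∧ y ∈ S)) : S ⊆ side T x y := by
  intro t ht
  by_contra hc
  exact hxy (mem_of_meets_sides hT hS h hs ht hs' hc)

/-- A connected set containing two neighbors of `x` contains `x`. -/
theorem mem_of_two_neighbors (hT : T.IsAcyclic) {S : Set X} (hS : (T.induce S).Preconnected)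
    {x y z : X} (hy : T.Adj x y) (hz : T.Adj x z) (hne : y ≠ z) (hyS : y ∈ S) (hzS : z ∈ S) :
    x ∈ S :=
  (mem_of_meets_sides hT hS hy.symm hyS hzS (left_mem_side y x)
    (neighbor_notMem_side hT hy hz hne.symm)).2

theorem IsPathSet.preconnected {S : Set X} (h : IsPathSet T S) : (T.induce S).Preconnected := by
  obtain ⟨x, y, p, -, rfl⟩ := h
  exact p.connected_induce_support.preconnected

theorem tail_notMem_side (hT : T.IsAcyclic) {a c b : X} (h : T.Adj a c) (p : T.Walk c b)
    (ha : a ∉ p.support) {z : X} (hz : z ∈ p.support) : z ∉ side T a c := by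
  intro hzs
  have hS := p.connected_induce_support.preconnected
  exact ha (mem_of_meets_sides hT hS h hz p.start_mem_support hzs (right_notMem_side hT h)).1

/-- Adjacent nodes on a path of a tree are consecutive. -/
theorem mem_edges_of_adj (hT : T.IsAcyclic) {a b : X} {p : T.Walk a b} (hp : p.IsPath) {x y : X}
    (hx : x ∈ p.support) (hy : y ∈ p.support) (hxy : T.Adj x y) : s(x, y) ∈ p.edges := by
  induction p with
  | nil =>
    simp only [SimpleGraph.Walk.support_nil, List.mem_singleton] at hx hy
    exact absurd (hx.trans hy.symm) hxy.ne
  | @cons a c b h p ih =>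
    rw [SimpleGraph.Walk.cons_isPath_iff] at hp
    have key : ∀ {y : X}, y ∈ p.support → T.Adj a y → y = c := fun hy hay =>
      (eq_of_adj_side hT h (left_mem_side a c) (tail_notMem_side hT h p hp.2 hy) hay).2
    rw [SimpleGraph.Walk.support_cons, List.mem_cons] at hx hy
    rw [SimpleGraph.Walk.edges_cons, List.mem_cons]
    rcases hx with rfl | hx
    · rcases hy with rfl | hy
      · exact absurd rfl hxy.ne
      · exact Or.inl (by rw [key hy hxy])
    · rcases hy with rfl | hy
      · exact Or.inl (by rw [key hx hxy.symm, Sym2.eq_swap])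
      · exact Or.inr (ih hp.1 hx hy)

theorem eq_of_mem_edges_start {a b : X} {p : T.Walk a b} (hp : p.IsPath) {y : X}
    (hy : s(a, y) ∈ p.edges) : y = p.snd := by
  cases p with
  | nil => simp at hy
  | @cons _ c _ h p =>
    rw [SimpleGraph.Walk.cons_isPath_iff] at hp
    rw [SimpleGraph.Walk.edges_cons, List.mem_cons] at hy
    rcases hy with hy | hy
    · rw [SimpleGraph.Walk.snd_cons]
      exact Sym2.congr_right.1 hy
    · exact absurd (p.fst_mem_support_of_mem_edges hy) hp.2

theorem not_three_edges {a b : X} {p : T.Walk a b} (hp : p.IsPath) {x y z w : X}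
    (hyz : y ≠ z) (hyw : y ≠ w) (hzw : z ≠ w) (hy : s(x, y) ∈ p.edges) (hz : s(x, z) ∈ p.edges)
    (hw : s(x, w) ∈ p.edges) : False := by
  induction p with
  | nil => simp at hy
  | @cons a c b h p ih =>
    by_cases hxa : x = a
    · subst hxa
      exact hyz ((eq_of_mem_edges_start hp hy).trans (eq_of_mem_edges_start hp hz).symm)
    have key : ∀ {y : X}, s(x, y) ∈ (SimpleGraph.Walk.cons h p).edges →
        (x = c ∧ y = a) ∨ s(x, y) ∈ p.edges := by
      intro y hy
      rw [SimpleGraph.Walk.edges_cons, List.mem_cons, Sym2.eq_iff] at hy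
      tauto
    have hp' := hp.of_cons
    have key2 : ∀ {y z : X}, x = c → s(x, y) ∈ p.edges → s(x, z) ∈ p.edges → y = z := by
      rintro y z rfl hy hz
      exact (eq_of_mem_edges_start hp' hy).trans (eq_of_mem_edges_start hp' hz).symm
    rcases key hy with ⟨h1, h2⟩ | h1 <;> rcases key hz with ⟨h3, h4⟩ | h3 <;>
      rcases key hw with ⟨h5, h6⟩ | h5
    · exact hyz (h2.trans h4.symm)
    · exact hyz (h2.trans h4.symm)
    · exact hyw (h2.trans h6.symm)
    · exact hzw (key2 h1 h3 h5)
    · exact hzw (h4.trans h6.symm)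
    · exact hyw (key2 h3 h1 h5)
    · exact hyz (key2 h5 h1 h3)
    · exact ih hp' h1 h3 h5

theorem IsPathSet.not_three_neighbors (hT : T.IsAcyclic) {S : Set X} (h : IsPathSet T S)
    {x y z w : X} (hy : T.Adj x y) (hz : T.Adj x z) (hw : T.Adj x w)
    (hyz : y ≠ z) (hyw : y ≠ w) (hzw : z ≠ w) (hyS : y ∈ S) (hzS : z ∈ S) (hwS : w ∈ S) :
    False := by
  have hxS : x ∈ S := mem_of_two_neighbors hT h.preconnected hy hz hyz hyS hzS
  obtain ⟨a, b, p, hp, rfl⟩ := h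
  exact not_three_edges hp hyz hyw hzw (mem_edges_of_adj hT hp hxS hyS hy)
    (mem_edges_of_adj hT hp hxS hzS hz) (mem_edges_of_adj hT hp hxS hwS hw)

/-- An inner node of a path lies on two of its edges. -/
theorem exists_two_edges_of_inner {a b : X} {p : T.Walk a b} (hp : p.IsPath) {z : X}
    (hz : z ∈ innerVerts p) : ∃ y₁ y₂, y₁ ≠ y₂ ∧ s(z, y₁) ∈ p.edges ∧ s(z, y₂) ∈ p.edges := by
  induction p with
  | nil =>
    obtain ⟨h1, h2, -⟩ := hz
    simp only [SimpleGraph.Walk.support_nil, List.mem_singleton] at h1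
    exact absurd h1 h2
  | @cons a c b h p ih =>
    obtain ⟨h1, h2, h3⟩ := hz
    rw [SimpleGraph.Walk.support_cons, List.mem_cons] at h1
    have h1 := h1.resolve_left h2
    by_cases hzc : z = c
    · subst hzc
      cases p with
      | nil => exact absurd rfl h3
      | @cons _ d _ h' p =>
        refine ⟨a, d, ?_, ?_, ?_⟩
        · rintro rfl
          rw [SimpleGraph.Walk.cons_isPath_iff] at hp
          exact hp.2 (by simp)
        · simp [SimpleGraph.Walk.edges_cons, Sym2.eq_swap]
        · simp [SimpleGraph.Walk.edges_cons]
    · obtain ⟨y₁, y₂, h4, h5, h6⟩ := ih hp.of_cons ⟨h1, hzc, h3⟩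
      exact ⟨y₁, y₂, h4, by simp [SimpleGraph.Walk.edges_cons, h5],
        by simp [SimpleGraph.Walk.edges_cons, h6]⟩

/-- All edges at an inner node of degree two belong to the path. -/
theorem mem_edges_of_inner {a b : X} {p : T.Walk a b} (hp : p.IsPath) {z : X}
    (hz : z ∈ innerVerts p) (hdeg : (T.neighborSet z).ncard = 2) {y : X} (hy : T.Adj z y) :
    s(z, y) ∈ p.edges := by
  obtain ⟨y₁, y₂, hne, h1, h2⟩ := exists_two_edges_of_inner hp hz
  have hfin : (T.neighborSet z).Finite := Set.finite_of_ncard_ne_zero (by omega)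
  have hsub : ({y₁, y₂} : Set X) ⊆ T.neighborSet z := by
    rintro w (rfl | rfl)
    · exact p.adj_of_mem_edges h1
    · exact p.adj_of_mem_edges h2
  have heq := Set.eq_of_subset_of_ncard_le hsub (by rw [hdeg, Set.ncard_pair hne]) hfin
  have : y ∈ ({y₁, y₂} : Set X) := heq ▸ hy
  rcases this with rfl | rfl
  · exact h1
  · exact h2

theorem ncard_innerVerts {a b : X} {p : T.Walk a b} (hp : p.IsPath) (hab : a ≠ b) :
    (innerVerts p).ncard = p.length - 1 := by
  classical
  have h1 : innerVerts p = ((p.support.toFinset \ {a, b} : Finset X) : Set X) := by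
    ext z
    simp [innerVerts]
  rw [h1, Set.ncard_coe_finset, Finset.card_sdiff_of_subset, Finset.card_pair hab,
    List.toFinset_card_of_nodup hp.support_nodup, SimpleGraph.Walk.length_support]
  · omega
  · intro z hz
    simp only [Finset.mem_insert, Finset.mem_singleton] at hz
    rcases hz with rfl | rfl <;> simp

end Trees

/-! ### Local structure of a clique NC-path-tree model -/

section Structure

variable {V X : Type*} {G : SimpleGraph V} {T : SimpleGraph X} {P : V → Set X}

theorem IsTerminal.eq_of_adj {x y z : X} {v : V} (h : IsTerminal T P x) (hx : x ∈ P v)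
    (hy : y ∈ P v) (hz : z ∈ P v) (hxy : T.Adj x y) (hxz : T.Adj x z) : y = z := by
  by_contra hne
  exact (h v hx).2 ⟨hx, y, hy, z, hz, hne, hxy, hxz⟩

theorem exists_of_not_isTerminal {x : X} (h : ¬ IsTerminal T P x) :
    ∃ v, x ∈ P v ∧ ∃ y ∈ P v, ∃ z ∈ P v, y ≠ z ∧ T.Adj x y ∧ T.Adj x z := by
  simp only [IsTerminal, IsLeaf, not_forall, not_and, not_not] at h
  obtain ⟨v, hx, hi⟩ := h
  exact ⟨v, hx, (hi hx).2⟩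

/-- A node with exactly three neighbors, any two of which lie on a common guest through it. -/
def IsTripod (T : SimpleGraph X) (P : V → Set X) (x : X) : Prop :=
  (∃ y z w, y ≠ z ∧ y ≠ w ∧ z ≠ w ∧ T.neighborSet x = {y, z, w}) ∧
    ∀ y z, T.Adj x y → T.Adj x z → y ≠ z → ∃ v, x ∈ P v ∧ y ∈ P v ∧ z ∈ P v

theorem IsTripod.exists_others {x y : X} (h : IsTripod T P x) (hy : T.Adj x y) :
    ∃ z w, y ≠ z ∧ y ≠ w ∧ z ≠ w ∧ T.Adj x z ∧ T.Adj x w ∧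
      ∀ q, T.Adj x q → q = y ∨ q = z ∨ q = w := by
  obtain ⟨⟨a, b, c, hab, hac, hbc, hN⟩, -⟩ := h
  have hmem : ∀ q, T.Adj x q ↔ q = a ∨ q = b ∨ q = c := fun q => by
    rw [← SimpleGraph.mem_neighborSet, hN]; simp
  rcases (hmem y).1 hy with rfl | rfl | rfl
  · exact ⟨b, c, hab, hac, hbc, by simp [hmem], by simp [hmem], fun q hq => (hmem q).1 hq⟩
  · exact ⟨a, c, hab.symm, hbc, hac, by simp [hmem], by simp [hmem],
      fun q hq => by have := (hmem q).1 hq; tauto⟩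
  · exact ⟨a, b, hac.symm, hbc.symm, hab, by simp [hmem], by simp [hmem],
      fun q hq => by have := (hmem q).1 hq; tauto⟩

/-- Guests over two pairs of neighbors that share a node already reach all three neighbors. This is
the upper bound two at a junction. -/
theorem IsTripod.exists_two {x : X} (h : IsTripod T P x) :
    ∃ u v, x ∈ P u ∧ x ∈ P v ∧ ∀ y, T.Adj x y → y ∈ P u ∨ y ∈ P v := by
  obtain ⟨⟨y, z, w, hyz, hyw, hzw, hN⟩, h2⟩ := h
  have hmem : ∀ q, T.Adj x q ↔ q = y ∨ q = z ∨ q = w := fun q => by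
    rw [← SimpleGraph.mem_neighborSet, hN]; simp
  obtain ⟨u, hxu, hyu, hzu⟩ := h2 y z (by simp [hmem]) (by simp [hmem]) hyz
  obtain ⟨v, hxv, hyv, hwv⟩ := h2 y w (by simp [hmem]) (by simp [hmem]) hyw
  refine ⟨u, v, hxu, hxv, fun q hq => ?_⟩
  rcases (hmem q).1 hq with rfl | rfl | rfl <;> simp [*]

namespace IsCliqueNCPathTreeModel

variable (hM : IsCliqueNCPathTreeModel G T P)
include hM

theorem isAcyclic : T.IsAcyclic := hM.isTree.isAcyclic

theorem preconnected (v : V) : (T.induce (P v)).Preconnected := (hM.isPath v).preconnected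

theorem exists_mem_notMem {x y : X} (hxy : x ≠ y) : ∃ v, x ∈ P v ∧ y ∉ P v := by
  by_contra hc
  push Not at hc
  have hx : Maximal G.IsClique (bag P x) := by
    have : bag P x ∈ Set.range (bag P) := ⟨x, rfl⟩
    rwa [hM.range_bag] at this
  have hy : Maximal G.IsClique (bag P y) := by
    have : bag P y ∈ Set.range (bag P) := ⟨y, rfl⟩
    rwa [hM.range_bag] at this
  exact hxy (hM.bag_injective (hx.eq_of_subset hy.prop hc))

/-- Otherwise the connected set `P u \ P v` would cross the edge `xz` and so contain `x`, a node of
`P v`. This is how non-crossing enters. -/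
theorem notMem_side_of_mem_diff {x z q : X} {u v : V} (hxz : T.Adj x z) (hxv : x ∈ P v)
    (hzu : z ∈ P u) (hzv : z ∉ P v) (hqu : q ∈ P u) (hqv : q ∉ P v) : q ∉ side T x z := by
  intro hq
  exact (mem_of_meets_sides hM.isAcyclic (hM.nonCrossing u v).1 hxz ⟨hqu, hqv⟩ ⟨hzu, hzv⟩ hq
    (right_notMem_side hM.isAcyclic hxz)).1.2 hxv

/-- If one guest passes `x` through `y` and `z`, any guest containing `x` contains `y` or `z`. -/
theorem mem_or_mem {x y z : X} {u v : V} (hy : T.Adj x y) (hz : T.Adj x z) (hne : y ≠ z)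
    (hyu : y ∈ P u) (hzu : z ∈ P u) (hxv : x ∈ P v) : y ∈ P v ∨ z ∈ P v := by
  by_contra! hc
  exact hM.notMem_side_of_mem_diff hz hxv hzu hc.2 hyu hc.1
    (neighbor_mem_side hM.isAcyclic hz hy hne)

theorem not_three {x y z w : X} {v : V} (hy : T.Adj x y) (hz : T.Adj x z) (hw : T.Adj x w)
    (hyz : y ≠ z) (hyw : y ≠ w) (hzw : z ≠ w) (hyv : y ∈ P v) (hzv : z ∈ P v) : w ∉ P v :=
  fun hwv => (hM.isPath v).not_three_neighbors hM.isAcyclic hy hz hw hyz hyw hzw hyv hzv hwv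

theorem eq_or_isTripod {x : X} (h : ¬ IsTerminal T P x) :
    (∃ y z, y ≠ z ∧ T.neighborSet x = {y, z}) ∨ IsTripod T P x := by
  obtain ⟨u, hxu, y, hyu, z, hzu, hyz, hy, hz⟩ := exists_of_not_isTerminal h
  by_cases hN : T.neighborSet x ⊆ {y, z}
  · refine Or.inl ⟨y, z, hyz, hN.antisymm ?_⟩
    rintro q (rfl | rfl) <;> assumption
  right
  obtain ⟨w, hw, hwyz⟩ := Set.not_subset.1 hN
  simp only [Set.mem_insert_iff, Set.mem_singleton_iff, not_or] at hwyz
  obtain ⟨hwy, hwz⟩ : w ≠ y ∧ w ≠ z := hwyz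
  rw [SimpleGraph.mem_neighborSet] at hw
  -- each of the other two pairs lies on a guest
  have hpairs : (∃ v, x ∈ P v ∧ y ∈ P v ∧ w ∈ P v) ∧ (∃ v, x ∈ P v ∧ z ∈ P v ∧ w ∈ P v) := by
    obtain ⟨v, hxv, hwv⟩ := hM.edge_covered x w hw
    rcases hM.mem_or_mem hy hz hyz hyu hzu hxv with h1 | h1
    · refine ⟨⟨v, hxv, h1, hwv⟩, ?_⟩
      -- The pairs `yz` and `yw` both lie on guests, so a guest through `x` missing the shared node
      -- `y` contains `z` and `w`.
      obtain ⟨t, hxt, hyt⟩ := hM.exists_mem_notMem hy.ne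
      exact ⟨t, hxt, (hM.mem_or_mem hy hz hyz hyu hzu hxt).resolve_left hyt,
        (hM.mem_or_mem hy hw hwy.symm h1 hwv hxt).resolve_left hyt⟩
    · refine ⟨?_, ⟨v, hxv, h1, hwv⟩⟩
      obtain ⟨t, hxt, hzt⟩ := hM.exists_mem_notMem hz.ne
      exact ⟨t, hxt, (hM.mem_or_mem hy hz hyz hyu hzu hxt).resolve_right hzt,
        (hM.mem_or_mem hz hw hwz.symm h1 hwv hxt).resolve_left hzt⟩
  obtain ⟨⟨v, hxv, hyv, hwv⟩, ⟨t, hxt, hzt, hwt⟩⟩ := hpairs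
  have hall : ∀ q, T.Adj x q → q = y ∨ q = z ∨ q = w := by
    intro q hq
    by_contra! hc
    obtain ⟨s, hxs, hqs⟩ := hM.edge_covered x q hq
    -- A guest over the fourth edge has room for only one of `y`, `z`, `w`, yet it must meet all
    -- three pairs.
    have h1 := hM.mem_or_mem hy hz hyz hyu hzu hxs
    have h2 := hM.mem_or_mem hy hw hwy.symm hyv hwv hxs
    have h3 := hM.mem_or_mem hz hw hwz.symm hzt hwt hxs
    have h4 := hM.not_three (v := s) hq hy hz hc.1 hc.2.1 hyz hqs
    have h5 := hM.not_three (v := s) hq hy hw hc.1 hc.2.2 hwy.symm hqs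
    have h6 := hM.not_three (v := s) hq hz hw hc.2.1 hc.2.2 hwz.symm hqs
    tauto
  refine ⟨⟨y, z, w, hyz, hwy.symm, hwz.symm, ?_⟩, ?_⟩
  · ext q
    simp only [SimpleGraph.mem_neighborSet, Set.mem_insert_iff, Set.mem_singleton_iff]
    refine ⟨hall q, ?_⟩
    rintro (rfl | rfl | rfl) <;> assumption
  · intro p q hp hq hpq
    rcases hall p hp with rfl | rfl | rfl <;> rcases hall q hq with rfl | rfl | rfl
    · exact absurd rfl hpq
    · exact ⟨u, hxu, hyu, hzu⟩
    · exact ⟨v, hxv, hyv, hwv⟩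
    · exact ⟨u, hxu, hzu, hyu⟩
    · exact absurd rfl hpq
    · exact ⟨t, hxt, hzt, hwt⟩
    · exact ⟨v, hxv, hwv, hyv⟩
    · exact ⟨t, hxt, hwt, hzt⟩
    · exact absurd rfl hpq

theorem mem_or_mem_of_isTripod {x y z : X} {v : V} (h : IsTripod T P x) (hy : T.Adj x y)
    (hz : T.Adj x z) (hne : y ≠ z) (hxv : x ∈ P v) : y ∈ P v ∨ z ∈ P v := by
  obtain ⟨u, -, hyu, hzu⟩ := h.2 y z hy hz hne
  exact hM.mem_or_mem hy hz hne hyu hzu hxv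

/-- At a node of degree two, some guest through the node misses a neighbor and therefore ends there.
-/
theorem isTripod_of_isJunction {x : X} (h : IsJunction T P x) : IsTripod T P x := by
  have hnt : ¬ IsTerminal T P x := by
    intro ht
    obtain ⟨v, hv⟩ := hM.node_covered x
    exact (ht v hv).2 (h v hv)
  refine (hM.eq_or_isTripod hnt).resolve_left ?_
  rintro ⟨y, z, hyz, hN⟩
  have hxy : T.Adj x y := by rw [← SimpleGraph.mem_neighborSet, hN]; simp
  obtain ⟨v, hxv, hyv⟩ := hM.exists_mem_notMem hxy.ne
  obtain ⟨-, p, hp, q, hq, hpq, hxp, hxq⟩ := h v hxv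
  rw [← SimpleGraph.mem_neighborSet, hN] at hxp hxq
  rcases hxp with rfl | rfl
  · exact hyv hp
  rcases hxq with rfl | rfl
  · exact hyv hq
  · exact hpq rfl

/-- A guest through `x` meets each of the three pairs of neighbors, so it contains at least two
neighbors. -/
theorem isJunction_of_isTripod {x : X} (h : IsTripod T P x) : IsJunction T P x := by
  intro v hxv
  obtain ⟨⟨y, z, w, hyz, hyw, hzw, hN⟩, -⟩ := id h
  have hy : T.Adj x y := by rw [← SimpleGraph.mem_neighborSet, hN]; simp
  have hz : T.Adj x z := by rw [← SimpleGraph.mem_neighborSet, hN]; simp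
  have hw : T.Adj x w := by rw [← SimpleGraph.mem_neighborSet, hN]; simp
  refine ⟨hxv, ?_⟩
  rcases hM.mem_or_mem_of_isTripod h hy hz hyz hxv with h1 | h1
  · rcases hM.mem_or_mem_of_isTripod h hz hw hzw hxv with h2 | h2
    · exact ⟨y, h1, z, h2, hyz, hy, hz⟩
    · exact ⟨y, h1, w, h2, hyw, hy, hw⟩
  · rcases hM.mem_or_mem_of_isTripod h hy hw hyw hxv with h2 | h2
    · exact ⟨z, h1, y, h2, hyz.symm, hz, hy⟩
    · exact ⟨z, h1, w, h2, hzw, hz, hw⟩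

/-- The neighbors of a junction are terminals. -/
theorem isTerminal_of_adj_isTripod {x y : X} (h : IsTripod T P x) (hxy : T.Adj x y) :
    IsTerminal T P y := by
  have hT := hM.isAcyclic
  by_contra hnt
  -- If `y` is not terminal, two guests over `xy` part at `y`: `u` continues to `q` and `s` does
  -- not.
  obtain ⟨q, hyq, hqx, s, u, hxs, hys, hqs, hxu, hyu, hqu⟩ : ∃ q, T.Adj y q ∧ q ≠ x ∧ ∃ s u,
      x ∈ P s ∧ y ∈ P s ∧ q ∉ P s ∧ x ∈ P u ∧ y ∈ P u ∧ q ∈ P u := by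
    rcases hM.eq_or_isTripod hnt with ⟨a, b, hab, hN⟩ | htri
    · obtain ⟨u, hyu, c, hcu, d, hdu, hcd, hyc, hyd⟩ := exists_of_not_isTerminal hnt
      obtain ⟨q, hyq, hqx, hqu, hxu⟩ : ∃ q, T.Adj y q ∧ q ≠ x ∧ q ∈ P u ∧ x ∈ P u := by
        have hx : x ∈ ({a, b} : Set X) := hN ▸ hxy.symm
        have hc : c ∈ ({a, b} : Set X) := hN ▸ hyc
        have hd : d ∈ ({a, b} : Set X) := hN ▸ hyd
        by_cases hcx : c = x
        · exact ⟨d, hyd, fun e => hcd (hcx.trans e.symm), hdu, hcx ▸ hcu⟩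
        · refine ⟨c, hyc, hcx, hcu, ?_⟩
          have : d = x := by
            simp only [Set.mem_insert_iff, Set.mem_singleton_iff] at hx hc hd
            grind
          exact this ▸ hdu
      obtain ⟨s, hys, hqs⟩ := hM.exists_mem_notMem hyq.ne
      exact ⟨q, hyq, hqx, s, u,
        (hM.mem_or_mem hyq hxy.symm hqx hqu hxu hys).resolve_left hqs, hys, hqs, hxu, hyu, hqu⟩
    · obtain ⟨q, r, hxq, hxr, hqr, hyq, hyr, -⟩ := htri.exists_others hxy.symm
      obtain ⟨u, hyu, hxu, hqu⟩ := htri.2 x q hxy.symm hyq hxq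
      obtain ⟨s, hys, hxs, hrs⟩ := htri.2 x r hxy.symm hyr hxr
      exact ⟨q, hyq, hxq.symm, s, u, hxs, hys,
        hM.not_three hxy.symm hyr hyq hxr hxq hqr.symm hxs hrs, hxu, hyu, hqu⟩
  obtain ⟨z, w, hyz, hyw, hzw, hxz, hxw, hzu⟩ : ∃ z w, y ≠ z ∧ y ≠ w ∧ z ≠ w ∧ T.Adj x z ∧
      T.Adj x w ∧ z ∈ P u := by
    obtain ⟨z, w, hyz, hyw, hzw, hxz, hxw, -⟩ := h.exists_others hxy
    rcases hM.mem_or_mem_of_isTripod h hxz hxw hzw hxu with hz | hw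
    · exact ⟨z, w, hyz, hyw, hzw, hxz, hxw, hz⟩
    · exact ⟨w, z, hyw, hyz, hzw.symm, hxw, hxz, hw⟩
  -- The node `q` hangs behind `y`, hence on the side of `x` for every other edge at `x`. Two guests
  -- whose difference contains `q` and `r` but not `x` would cross.
  have hside : ∀ {r}, T.Adj x r → y ≠ r → q ∈ side T x r := by
    intro r hxr hyr
    by_contra hc
    exact hxy.ne (eq_of_adj_side hT hxr (neighbor_mem_side hT hxr hxy hyr) hc hyq).1.symm
  have hzs : z ∈ P s := by
    by_contra hzs
    exact hM.notMem_side_of_mem_diff hxz hxs hzu hzs hqu hqs (hside hxz hyz)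
  -- Within the star at `x`, `s` and `u` turn from `y` to `z`, while `t` turns from `y` to `w`. So
  -- `t` crosses `s` if it contains `q`, and crosses `u` if it does not.
  obtain ⟨t, hxt, hyt, hwt⟩ := h.2 y w hxy hxw hyw
  have hzt : z ∉ P t := hM.not_three hxy hxw hxz hyw hyz hzw.symm hyt hwt
  have hws : w ∉ P s := hM.not_three hxy hxz hxw hyz hyw hzw hys hzs
  by_cases hqt : q ∈ P t
  · exact hM.notMem_side_of_mem_diff hxw hxs hwt hws hqt hqs (hside hxw hyw)
  · exact hM.notMem_side_of_mem_diff hxz hxt hzu hzt hqu hqt (hside hxz hyz)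

theorem notMem_of_isTripod {x : X} (h : IsTripod T P x) (v : V) : ∃ y, T.Adj x y ∧ y ∉ P v := by
  obtain ⟨⟨y, z, w, hyz, hyw, hzw, hN⟩, -⟩ := id h
  have hy : T.Adj x y := by rw [← SimpleGraph.mem_neighborSet, hN]; simp
  have hz : T.Adj x z := by rw [← SimpleGraph.mem_neighborSet, hN]; simp
  have hw : T.Adj x w := by rw [← SimpleGraph.mem_neighborSet, hN]; simp
  by_contra! hc
  exact hM.not_three hy hz hw hyz hyw hzw (hc y hy) (hc z hz) (hc w hw)

/-- A guest through a junction covers only edges at the junction. -/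
theorem eq_of_adj_of_isTripod {x c d : X} {v : V} (h : IsTripod T P x) (hxv : x ∈ P v)
    (hc : c ∈ P v) (hd : d ∈ P v) (hcd : T.Adj c d) : c = x ∨ d = x := by
  have hT := hM.isAcyclic
  -- The neighbors of `x` are terminals, so a guest coming from `x` ends at them.
  have hsub : P v ⊆ insert x (T.neighborSet x) := by
    intro t ht
    by_contra hct
    obtain ⟨a, ha, b, hb, h1, h2, hab⟩ := exists_crossing (hM.preconnected v) hxv ht
      (Set.mem_insert _ _) hct
    rcases h1 with rfl | h1
    · exact h2 (Or.inr hab)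
    · have := (hM.isTerminal_of_adj_isTripod h h1).eq_of_adj ha hxv hb (SimpleGraph.Adj.symm h1) hab
      exact h2 (Or.inl this.symm)
  by_contra! hne
  have hxc : T.Adj x c := (hsub hc).resolve_left hne.1
  have hxd : T.Adj x d := (hsub hd).resolve_left hne.2
  exact hne.2 (eq_of_adj_side hT hxc.symm (left_mem_side c x)
    (neighbor_notMem_side hT hxc hxd hcd.ne.symm) hcd).2

/-- A guest covering an edge between terminals covers no other edge. -/
theorem subset_pair_of_isTerminal {x y : X} {v : V} (hx : IsTerminal T P x)
    (hy : IsTerminal T P y) (hxy : T.Adj x y) (hxv : x ∈ P v) (hyv : y ∈ P v) :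
    P v ⊆ {x, y} := by
  intro t ht
  by_contra hct
  obtain ⟨a, ha, b, hb, h1, h2, hab⟩ := exists_crossing (hM.preconnected v) hxv ht
    (A := {x, y}) (by simp) hct
  rcases h1 with rfl | rfl
  · exact h2 (Or.inr (hx.eq_of_adj hxv hyv hb hxy hab).symm)
  · exact h2 (Or.inl (hy.eq_of_adj hyv hxv hb hxy.symm hab).symm)

/-- A guest containing `z` but not `x` meets `P u` at `z`, while `P v` stays on the side of `x` and
cannot meet it. -/
theorem not_twins {x z : X} {u v : V} (hxz : T.Adj x z) (hxv : x ∈ P v)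
    (hzu : z ∈ P u) (hzv : z ∉ P v) : ¬ Twins G u v := by
  rintro ⟨-, heq⟩
  obtain ⟨s, hzs, hxs⟩ := hM.exists_mem_notMem hxz.ne.symm
  have hs : s ∈ insert u (G.neighborSet u) := by
    by_cases hsu : s = u
    · exact Or.inl hsu
    · exact Or.inr ((hM.adj_iff u s (Ne.symm hsu)).2 ⟨z, hzu, hzs⟩)
  rw [heq] at hs
  rcases hs with rfl | hs
  · exact hxs hxv
  · rw [SimpleGraph.mem_neighborSet] at hs
    obtain ⟨r, hrv, hrs⟩ := (hM.adj_iff v s hs.ne).1 hs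
    have h1 := subset_side hM.isAcyclic (hM.preconnected v) hxz hxv (left_mem_side x z)
      (fun h => hzv h.2) hrv
    exact hxs (mem_of_meets_sides hM.isAcyclic (hM.preconnected s) hxz hrs hzs h1
      (right_notMem_side hM.isAcyclic hxz)).1

end IsCliqueNCPathTreeModel

end Structure

/-! ### Terminal paths -/

section TerminalPaths

variable {V X : Type*} {G : SimpleGraph V} {T : SimpleGraph X} {P : V → Set X}

theorem innerVerts_reverse {a b : X} (p : T.Walk a b) : innerVerts p.reverse = innerVerts p := by
  ext z
  simp only [innerVerts, SimpleGraph.Walk.support_reverse, List.mem_reverse, Set.mem_ofPred_eq]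
  tauto

theorem IsTerminalPath.reverse {a b : X} {p : T.Walk a b} (h : IsTerminalPath T P p) :
    IsTerminalPath T P p.reverse := by
  obtain ⟨h1, h2, h3, h4, h5⟩ := h
  exact ⟨h1.reverse, by simpa using h2, h4, h3, by rwa [innerVerts_reverse]⟩

/-- Past its start the path lies beyond the first edge, which a connected set avoiding `p.snd`
cannot cross. Applied to a vertex of `G_{z₁} \ G_{z₂}`, it says that the guest meets the path in
`z₁` alone. -/
theorem eq_start_of_snd_notMem (hT : T.IsAcyclic) {a b z : X} {p : T.Walk a b} (hp : p.IsPath)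
    {S : Set X} (hS : (T.induce S).Preconnected) (ha : a ∈ S) (hsnd : p.snd ∉ S) (hz : z ∈ S)
    (hzp : z ∈ p.support) : z = a := by
  cases p with
  | nil => simpa using hzp
  | @cons _ c _ h p =>
    rw [SimpleGraph.Walk.snd_cons] at hsnd
    rw [SimpleGraph.Walk.cons_isPath_iff] at hp
    rw [SimpleGraph.Walk.support_cons, List.mem_cons] at hzp
    refine hzp.resolve_right fun hzp => ?_
    exact hsnd (mem_of_meets_sides hT hS h ha hz (left_mem_side a c)
      (tail_notMem_side hT h p hp.2 hzp)).2

/-- The ends of a path are separated by each of its edges. -/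
theorem ends_separated (hT : T.IsAcyclic) {a b x y : X} {p : T.Walk a b} (hp : p.IsPath)
    (hxy : s(x, y) ∈ p.edges) :
    (a ∈ side T x y ∧ b ∉ side T x y) ∨ (a ∈ side T y x ∧ b ∉ side T y x) := by
  induction p with
  | nil => simp at hxy
  | @cons a c b h p ih =>
    rw [SimpleGraph.Walk.cons_isPath_iff] at hp
    rw [SimpleGraph.Walk.edges_cons, List.mem_cons, Sym2.eq_iff] at hxy
    have hb := tail_notMem_side hT h p hp.2 p.end_mem_support
    rcases hxy with (⟨rfl, rfl⟩ | ⟨rfl, rfl⟩) | hxy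
    · exact Or.inl ⟨left_mem_side _ _, hb⟩
    · exact Or.inr ⟨left_mem_side _ _, hb⟩
    · have hadj := p.adj_of_mem_edges hxy
      rcases ih hp.1 hxy with ⟨h1, h2⟩ | ⟨h1, h2⟩
      · refine Or.inl ⟨?_, h2⟩
        by_contra hc
        have := (eq_of_adj_side hT hadj h1 hc h.symm).2
        exact hp.2 (this ▸ p.snd_mem_support_of_mem_edges hxy)
      · refine Or.inr ⟨?_, h2⟩
        by_contra hc
        have := (eq_of_adj_side hT hadj.symm h1 hc h.symm).2
        exact hp.2 (this ▸ p.fst_mem_support_of_mem_edges hxy)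

/-- An edge without an inner node would join the two ends and be the whole path. -/
theorem inner_of_mem_edges {a b x y : X} {p : T.Walk a b} (hp : p.IsPath) (hlen : 2 ≤ p.length)
    (hxy : s(x, y) ∈ p.edges) : x ∈ innerVerts p ∨ y ∈ innerVerts p := by
  by_contra! hc
  have hx := p.fst_mem_support_of_mem_edges hxy
  have hy := p.snd_mem_support_of_mem_edges hxy
  have hne := (p.adj_of_mem_edges hxy).ne
  have hab : s(a, b) ∈ p.edges := by
    simp only [innerVerts, Set.mem_ofPred_eq, not_and, not_not] at hc
    have h1 := hc.1 hx
    have h2 := hc.2 hy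
    by_cases hxa : x = a
    · have : y = b := h2 fun e => hne (hxa.trans e.symm)
      have e : s(x, y) = s(a, b) := by rw [hxa, this]
      rw [← e]; exact hxy
    · have hxb := h1 hxa
      by_cases hya : y = a
      · have e : s(x, y) = s(a, b) := by rw [hya, hxb, Sym2.eq_swap]
        rw [← e]; exact hxy
      · exact absurd (hxb.trans (h2 hya).symm) hne
  have hsnd := eq_of_mem_edges_start hp hab
  cases p with
  | nil => simp at hlen
  | @cons _ c _ h p =>
    rw [SimpleGraph.Walk.snd_cons] at hsnd
    subst hsnd
    have := SimpleGraph.Walk.isPath_iff_nil.1 hp.of_cons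
    rw [← SimpleGraph.Walk.length_eq_zero_iff] at this
    simp [this] at hlen

theorem IsTerminalPath.ne {a b : X} {p : T.Walk a b} (h : IsTerminalPath T P p) : a ≠ b := by
  rintro rfl
  have := SimpleGraph.Walk.isPath_iff_nil.1 h.1
  rw [← SimpleGraph.Walk.length_eq_zero_iff] at this
  have := h.2.1
  omega

/-- A path through nonterminals of degree two. -/
structure IsLink (T : SimpleGraph X) (P : V → Set X) (x : X) {a b : X} (p : T.Walk a b) :
    Prop where
  isPath : p.IsPath
  mem : x ∈ innerVerts p
  inner : ∀ z ∈ innerVerts p, ¬ IsTerminal T P z ∧ (T.neighborSet z).ncard = 2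

theorem IsLink.reverse {x a b : X} {p : T.Walk a b} (h : IsLink T P x p) :
    IsLink T P x p.reverse :=
  ⟨h.isPath.reverse, by rw [innerVerts_reverse]; exact h.mem,
    by rw [innerVerts_reverse]; exact h.inner⟩

theorem IsLink.two_le_length {x a b : X} {p : T.Walk a b} (h : IsLink T P x p) :
    2 ≤ p.length := by
  obtain ⟨y₁, y₂, hne, h1, h2⟩ := exists_two_edges_of_inner h.isPath h.mem
  rw [← SimpleGraph.Walk.length_edges]
  by_contra! hlt
  match p.edges, h1, h2, hlt with
  | [e], h1, h2, _ =>
    rw [List.mem_singleton] at h1 h2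
    exact hne (Sym2.congr_right.1 (h1.trans h2.symm))

namespace IsCliqueNCPathTreeModel

variable (hM : IsCliqueNCPathTreeModel G T P)
include hM

/-- A guest through an inner node of a terminal path covers only edges of that path. -/
theorem mem_edges_of_innerBags {a b : X} {p : T.Walk a b} (hp : IsTerminalPath T P p) {w : V}
    (hw : w ∈ innerBags P p) {x y : X} (hx : x ∈ P w) (hy : y ∈ P w) (hxy : T.Adj x y) :
    s(x, y) ∈ p.edges := by
  have hT := hM.isAcyclic
  obtain ⟨z, hz, hzw⟩ := hw
  change z ∈ P w at hzw
  -- A guest joining the inner node `z` to the end `a` contains `p.snd`; as `a` is terminal, it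
  -- cannot continue to another neighbor.
  have hend : ∀ {a b : X} {p : T.Walk a b}, IsTerminalPath T P p → z ∈ innerVerts p → a ∈ P w →
      ∀ d ∈ P w, T.Adj a d → d ∈ p.support := by
    intro a b p hp hz ha d hd had
    have hsnd : p.snd ∈ P w := by
      by_contra hsnd
      exact hz.2.1 (eq_start_of_snd_notMem hT hp.1 (hM.preconnected w) ha hsnd hzw hz.1)
    have hnil : ¬ p.Nil := by
      rw [← SimpleGraph.Walk.length_eq_zero_iff]
      have := hp.2.1
      omega
    rw [hp.2.2.1.eq_of_adj ha hd hsnd had (p.adj_snd hnil)]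
    exact p.getVert_mem_support 1
  have hsub : P w ⊆ {t | t ∈ p.support} := by
    intro t ht
    by_contra hct
    obtain ⟨c, hc, d, hd, h1, h2, hcd⟩ := exists_crossing (hM.preconnected w) hzw ht
      (A := {t | t ∈ p.support}) hz.1 hct
    by_cases hca : c = a
    · subst hca
      exact h2 (hend hp hz hc d hd hcd)
    by_cases hcb : c = b
    · subst hcb
      have := hend hp.reverse (by rwa [innerVerts_reverse]) hc d hd hcd
      exact h2 (by simpa using this)
    have hcin : c ∈ innerVerts p := ⟨h1, hca, hcb⟩
    exact h2 (p.snd_mem_support_of_mem_edges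
      (mem_edges_of_inner hp.1 hcin (hp.2.2.2.2 c hcin) hcd))
  exact mem_edges_of_adj hT hp.1 (hsub hx) (hsub hy) hxy

/-- The end `a` has the nonterminal neighbor `p.snd`, so it is not a tripod. It therefore has degree
two, and its other neighbor extends the path. -/
theorem exists_longer_link {x a b : X} {p : T.Walk a b} (hp : IsLink T P x p)
    (ha : ¬ IsTerminal T P a) :
    ∃ (a' : X) (p' : T.Walk a' b), IsLink T P x p' ∧ p.length < p'.length := by
  have hT := hM.isAcyclic
  have hlen := hp.two_le_length
  have hnil : ¬ p.Nil := by
    rw [← SimpleGraph.Walk.length_eq_zero_iff]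
    omega
  have hadj := p.adj_snd hnil
  have hsnd : s(a, p.snd) ∈ p.edges :=
    mem_edges_of_adj hT hp.isPath p.start_mem_support (p.getVert_mem_support 1) hadj
  have hinner : p.snd ∈ innerVerts p :=
    (inner_of_mem_edges hp.isPath hlen hsnd).resolve_left fun h => h.2.1 rfl
  rcases hM.eq_or_isTripod ha with ⟨y, z, hyz, hN⟩ | htri
  swap
  · exact absurd (hM.isTerminal_of_adj_isTripod htri hadj) (hp.inner _ hinner).1
  obtain ⟨c, hc, hcs⟩ : ∃ c, T.Adj a c ∧ c ≠ p.snd := by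
    have hy : T.Adj a y := by rw [← SimpleGraph.mem_neighborSet, hN]; simp
    have hz : T.Adj a z := by rw [← SimpleGraph.mem_neighborSet, hN]; simp
    by_cases h : y = p.snd
    · exact ⟨z, hz, fun e => hyz (h.trans e.symm)⟩
    · exact ⟨y, hy, h⟩
  have hcp : c ∉ p.support := fun hcp => hcs (eq_of_mem_edges_start hp.isPath
    (mem_edges_of_adj hT hp.isPath p.start_mem_support hcp hc))
  refine ⟨c, SimpleGraph.Walk.cons hc.symm p, ⟨?_, ?_, ?_⟩, by simp⟩
  · exact SimpleGraph.Walk.cons_isPath_iff _ _ |>.2 ⟨hp.isPath, hcp⟩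
  · refine ⟨by simp [hp.mem.1], ?_, hp.mem.2.2⟩
    rintro rfl
    exact hcp hp.mem.1
  · rintro t ⟨h1, h2, h3⟩
    rw [SimpleGraph.Walk.support_cons, List.mem_cons] at h1
    have h1 := h1.resolve_left h2
    by_cases hta : t = a
    · subst hta
      exact ⟨ha, by rw [hN, Set.ncard_pair hyz]⟩
    · exact hp.inner t ⟨h1, hta, h3⟩

/-- A nonterminal of degree two is an inner node of a terminal path. -/
theorem exists_isTerminalPath [Finite X] {x : X} (hx : ¬ IsTerminal T P x)
    (hdeg : (T.neighborSet x).ncard = 2) :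
    ∃ (a b : X) (p : T.Walk a b), IsTerminalPath T P p ∧ x ∈ innerVerts p := by
  have := Fintype.ofFinite X
  by_contra hcon
  -- Without a terminal path, a link around `x` always has a nonterminal end at which it can grow,
  -- against finiteness of `T`.
  have hlong : ∀ n : ℕ, ∃ (a b : X) (p : T.Walk a b), IsLink T P x p ∧ n ≤ p.length := by
    intro n
    induction n with
    | zero =>
      obtain ⟨y, z, hyz, hN⟩ := Set.ncard_eq_two.1 hdeg
      have hy : T.Adj x y := by rw [← SimpleGraph.mem_neighborSet, hN]; simp
      have hz : T.Adj x z := by rw [← SimpleGraph.mem_neighborSet, hN]; simp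
      refine ⟨y, z, .cons hy.symm (.cons hz .nil), ⟨?_, ?_, ?_⟩, Nat.zero_le _⟩
      · simp [SimpleGraph.Walk.cons_isPath_iff, hz.ne, hy.ne.symm, hyz]
      · exact ⟨by simp, hy.ne, hz.ne⟩
      · rintro t ⟨h1, h2, h3⟩
        simp only [SimpleGraph.Walk.support_cons, SimpleGraph.Walk.support_nil, List.mem_cons,
          List.not_mem_nil, or_false] at h1
        have : t = x := by tauto
        exact this ▸ ⟨hx, hdeg⟩
    | succ n ih =>
      obtain ⟨a, b, p, hp, hn⟩ := ih
      by_cases ha : IsTerminal T P a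
      · by_cases hb : IsTerminal T P b
        · exact absurd ⟨a, b, p, ⟨hp.isPath, hp.two_le_length, ha, hb,
            fun z hz => (hp.inner z hz).2⟩, hp.mem⟩ hcon
        · obtain ⟨a', p', hp', hl⟩ := hM.exists_longer_link hp.reverse hb
          rw [SimpleGraph.Walk.length_reverse] at hl
          exact ⟨_, _, p', hp', by omega⟩
      · obtain ⟨a', p', hp', hl⟩ := hM.exists_longer_link hp ha
        exact ⟨_, _, p', hp', by omega⟩
  obtain ⟨a, b, p, hp, hn⟩ := hlong (Fintype.card X)
  exact absurd hp.isPath.length_lt (by omega)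

/-- A walk of `G` between the two sides of an edge of `T` uses a guest covering the edge. -/
theorem exists_mem_support_covering {x y : X} (hxy : T.Adj x y) {u v : V} (q : G.Walk u v)
    {s t : X} (hs : s ∈ P u) (hs' : s ∈ side T x y) (ht : t ∈ P v) (ht' : t ∉ side T x y) :
    ∃ w ∈ q.support, x ∈ P w ∧ y ∈ P w := by
  have hT := hM.isAcyclic
  induction q generalizing s with
  | nil => exact ⟨_, by simp, mem_of_meets_sides hT (hM.preconnected _) hxy hs ht hs' ht'⟩
  | @cons u w v h q ih =>
    by_cases hu : x ∈ P u ∧ y ∈ P u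
    · exact ⟨u, by simp, hu⟩
    have hsub := subset_side hT (hM.preconnected u) hxy hs hs' hu
    obtain ⟨r, hru, hrw⟩ := (hM.adj_iff u w h.ne).1 h
    obtain ⟨w', hw', h'⟩ := ih hrw (hsub hru) ht
    exact ⟨w', by simp [hw'], h'⟩

/-- The edge separates `a` from `b`, so some vertex of `q` covers it. This vertex is neither `u` nor
`v`, whose guests meet `p` in one node each. -/
theorem exists_innerVerts_covering {a b : X} {p : T.Walk a b} (hp : p.IsPath) {u v : V}
    (hu : u ∈ bag P a \ bag P p.snd) (hv : v ∈ bag P b \ bag P p.penultimate)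
    (q : G.Walk u v) {x y : X} (hxy : s(x, y) ∈ p.edges) :
    ∃ w ∈ innerVerts q, x ∈ P w ∧ y ∈ P w := by
  have hT := hM.isAcyclic
  have hadj := p.adj_of_mem_edges hxy
  have hx := p.fst_mem_support_of_mem_edges hxy
  have hy := p.snd_mem_support_of_mem_edges hxy
  obtain ⟨w, hw, hxw, hyw⟩ : ∃ w ∈ q.support, x ∈ P w ∧ y ∈ P w := by
    rcases ends_separated hT hp hxy with ⟨h1, h2⟩ | ⟨h1, h2⟩
    · exact hM.exists_mem_support_covering hadj q hu.1 h1 hv.1 h2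
    · obtain ⟨w, h3, h4, h5⟩ := hM.exists_mem_support_covering hadj.symm q hu.1 h1 hv.1 h2
      exact ⟨w, h3, h5, h4⟩
  refine ⟨w, ⟨hw, ?_, ?_⟩, hxw, hyw⟩
  · rintro rfl
    have key : ∀ z ∈ P w, z ∈ p.support → z = a := fun z hz hzp =>
      eq_start_of_snd_notMem hT hp (hM.preconnected w) hu.1 hu.2 hz hzp
    exact hadj.ne ((key x hxw hx).trans (key y hyw hy).symm)
  · rintro rfl
    have key : ∀ z ∈ P w, z ∈ p.support → z = b := fun z hz hzp =>
      eq_start_of_snd_notMem hT hp.reverse (hM.preconnected w) hv.1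
        (by rw [SimpleGraph.Walk.snd_reverse]; exact hv.2) hz (by simpa using hzp)
    exact hadj.ne ((key x hxw hx).trans (key y hyw hy).symm)

/-- Guests covering the edges of a walk of `T` connect its ends. -/
theorem exists_walk_of_covering {a b : X} (p : T.Walk a b) {E : Set V}
    (hE : ∀ x y, s(x, y) ∈ p.edges → ∃ w ∈ E, x ∈ P w ∧ y ∈ P w) {u v : V} (hu : a ∈ P u)
    (hv : b ∈ P v) : ∃ q : G.Walk u v, ∀ w ∈ q.support, w = u ∨ w = v ∨ w ∈ E := by
  induction p generalizing u with
  | nil =>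
    by_cases huv : u = v
    · subst huv
      exact ⟨.nil, by simp⟩
    · refine ⟨.cons ((hM.adj_iff u v huv).2 ⟨_, hu, hv⟩) .nil, ?_⟩
      simp
  | @cons a c b h p ih =>
    obtain ⟨w, hwE, haw, hcw⟩ := hE a c (by simp)
    obtain ⟨q, hq⟩ := ih (fun x y hxy => hE x y (by simp [hxy])) hcw hv
    have hq' : ∀ r ∈ q.support, r = u ∨ r = v ∨ r ∈ E := by
      intro r hr
      rcases hq r hr with rfl | h' | h'
      · exact Or.inr (Or.inr hwE)
      · exact Or.inr (Or.inl h')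
      · exact Or.inr (Or.inr h')
    by_cases huw : u = w
    · subst huw
      exact ⟨q, hq'⟩
    · refine ⟨.cons ((hM.adj_iff u w huw).2 ⟨a, hu, haw⟩) q, ?_⟩
      intro r hr
      rw [SimpleGraph.Walk.support_cons, List.mem_cons] at hr
      rcases hr with rfl | hr
      · exact Or.inl rfl
      · exact hq' r hr

end IsCliqueNCPathTreeModel

end TerminalPaths

/-! ### Connected dominating sets as edge covers of the host tree -/

section Covers

variable {V X : Type*} {G : SimpleGraph V} {T : SimpleGraph X} {P : V → Set X}

/-- Every edge of `T` lies on the guest of a vertex of `D`. -/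
def Covers (T : SimpleGraph X) (P : V → Set X) (D : Set V) : Prop :=
  ∀ x y, T.Adj x y → ∃ v ∈ D, x ∈ P v ∧ y ∈ P v

/-- An edge cover of `T` with the fewest vertices. -/
def IsMinCover (T : SimpleGraph X) (P : V → Set X) (D : Set V) : Prop :=
  Covers T P D ∧ ∀ D', Covers T P D' → D.ncard ≤ D'.ncard

/-- Replacing the part of `D` in `S` by `E` keeps a cover if `E` covers all that `S` covers. -/
theorem Covers.exchange {D S E : Set V} (hD : Covers T P D)
    (h : ∀ x y, T.Adj x y → (∃ w ∈ S, x ∈ P w ∧ y ∈ P w) → ∃ w ∈ E, x ∈ P w ∧ y ∈ P w) :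
    Covers T P (D \ S ∪ E) := by
  intro x y hxy
  obtain ⟨v, hv, hxv, hyv⟩ := hD x y hxy
  by_cases hvS : v ∈ S
  · obtain ⟨w, hw, h'⟩ := h x y hxy ⟨v, hvS, hxv, hyv⟩
    exact ⟨w, Or.inr hw, h'⟩
  · exact ⟨v, Or.inl ⟨hv, hvS⟩, hxv, hyv⟩

/-- The exchanged set is again a cover, so it is no smaller than `D`. This bounds a minimum cover
from above on each block. -/
theorem IsMinCover.ncard_inter_le [Finite V] {D S E : Set V} (hD : IsMinCover T P D)
    (h : ∀ x y, T.Adj x y → (∃ w ∈ S, x ∈ P w ∧ y ∈ P w) → ∃ w ∈ E, x ∈ P w ∧ y ∈ P w) :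
    (D ∩ S).ncard ≤ E.ncard := by
  have h1 := hD.2 _ (hD.1.exchange h)
  have h2 := Set.ncard_union_le (D \ S) E
  have h3 := Set.ncard_inter_add_ncard_sdiff_eq_ncard D S
  omega

/-- A cover is minimum if each of its vertices lies in a set on which it is locally optimal. -/
theorem Covers.isMinCover [Finite V] {D : Set V} (hD : Covers T P D)
    (h : ∀ v ∈ D, ∃ S : Set V, v ∈ S ∧
      (∀ x y, T.Adj x y → (∃ w ∈ S, x ∈ P w ∧ y ∈ P w) → ∃ w ∈ D ∩ S, x ∈ P w ∧ y ∈ P w) ∧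
      ∀ D', Covers T P D' → (D ∩ S).ncard ≤ (D' ∩ S).ncard) : IsMinCover T P D := by
  refine ⟨hD, fun D' hD' => ?_⟩
  -- Exchanging the part of `D'` in `S` for that of `D` does not enlarge `D'` and shrinks `D \ D'`.
  -- The process ends with `D ⊆ D'`, and the sets `S` need not be disjoint.
  generalize hn : (D \ D').ncard = n
  induction n using Nat.strong_induction_on generalizing D' with
  | _ n ih =>
    by_cases hsub : D ⊆ D'
    · exact Set.ncard_le_ncard hsub
    obtain ⟨v, hv, hv'⟩ := Set.not_subset.1 hsub
    obtain ⟨S, hvS, h1, h2⟩ := h v hv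
    have h3 := h2 D' hD'
    have hlt : (D \ (D' \ S ∪ D ∩ S)).ncard < n := by
      rw [← hn]
      refine Set.ncard_lt_ncard ⟨?_, fun hc => (hc ⟨hv, hv'⟩).2 (Or.inr ⟨hv, hvS⟩)⟩
      rintro w ⟨hw, hw'⟩
      refine ⟨hw, fun hwD' => hw' ?_⟩
      by_cases hwS : w ∈ S
      · exact Or.inr ⟨hw, hwS⟩
      · exact Or.inl ⟨hwD', hwS⟩
    have h4 := ih _ hlt _ (hD'.exchange h1) rfl
    have h5 := Set.ncard_union_le (D' \ S) (D ∩ S)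
    have h6 := Set.ncard_inter_add_ncard_sdiff_eq_ncard D' S
    omega

namespace IsCliqueNCPathTreeModel

variable (hM : IsCliqueNCPathTreeModel G T P)
include hM

theorem finite_nodes [Finite V] : Finite X := Finite.of_injective _ hM.bag_injective

theorem nontrivial_nodes (hG : G ≠ ⊤) : Nontrivial X := by
  obtain ⟨u, v, huv, hnadj⟩ : ∃ u v, u ≠ v ∧ ¬ G.Adj u v := by
    by_contra! hc
    refine hG (SimpleGraph.ext ?_)
    ext u v
    exact ⟨fun h => h.ne, fun h => hc u v h⟩
  obtain ⟨x, _, p, -, hp⟩ := hM.isPath u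
  obtain ⟨y, _, q, -, hq⟩ := hM.isPath v
  refine ⟨x, y, ?_⟩
  rintro rfl
  refine hnadj ((hM.adj_iff u v huv).2 ⟨x, ?_, ?_⟩)
  · rw [hp]; exact p.start_mem_support
  · rw [hq]; exact q.start_mem_support

/-- If no member of `D` covers `xy`, each member lies on one side. Vertices stopping at `x` and at
`y` need dominators on both sides, and connectedness of `D` then gives adjacent members on opposite
sides. -/
theorem covers_of_isConnectedDominating {D : Set V} (hD : IsConnectedDominating G D) :
    Covers T P D := by
  have hT := hM.isAcyclic
  intro x y hxy
  by_contra! hc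
  have near : ∀ u, ∃ d ∈ D, d = u ∨ G.Adj u d := by
    intro u
    rcases hD.1 u with h | ⟨w, hw, h⟩
    · exact ⟨u, h, Or.inl rfl⟩
    · exact ⟨w, hw, Or.inr h⟩
  have meet : ∀ {u d}, d = u ∨ G.Adj u d → ∃ r, r ∈ P u ∧ r ∈ P d := by
    rintro u d (rfl | h)
    · obtain ⟨a, _, p, -, hp⟩ := hM.isPath d
      exact ⟨a, by rw [hp]; exact p.start_mem_support, by rw [hp]; exact p.start_mem_support⟩
    · exact (hM.adj_iff u d h.ne).1 h
  obtain ⟨u, hxu, hyu⟩ := hM.exists_mem_notMem hxy.ne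
  obtain ⟨v, hyv, hxv⟩ := hM.exists_mem_notMem hxy.ne.symm
  have hu := subset_side hT (hM.preconnected u) hxy hxu (left_mem_side x y) (fun h => hyu h.2)
  obtain ⟨d, hd, hdu⟩ := near u
  obtain ⟨e, he, hev⟩ := near v
  obtain ⟨r, hru, hrd⟩ := meet hdu
  obtain ⟨t, htv, hte⟩ := meet hev
  have hd' : P d ⊆ side T x y :=
    subset_side hT (hM.preconnected d) hxy hrd (hu hru) (fun h => hc d hd h.1 h.2)
  have he' : ¬ P e ⊆ side T x y := by
    intro hsub
    exact hxv (mem_of_meets_sides hT (hM.preconnected v) hxy htv hyv (hsub hte)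
      (right_notMem_side hT hxy)).1
  obtain ⟨a, ha, b, hb, h1, h2, hab⟩ := exists_crossing (A := {w | P w ⊆ side T x y})
    hD.2.preconnected hd he hd' he'
  obtain ⟨s, hsa, hsb⟩ := (hM.adj_iff a b hab.ne).1 hab
  exact h2 (subset_side hT (hM.preconnected b) hxy hsb (h1 hsa) (fun h => hc b hb h.1 h.2))

/-- With at least two nodes, every node of `T` is on an edge, so `D` meets every bag and dominates.
Walks of `T` lift to walks in `D` because bags are cliques. -/
theorem isConnectedDominating_of_covers (hX : Nontrivial X) {D : Set V} (hD : Covers T P D) :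
    IsConnectedDominating G D := by
  have hnb : ∀ x, ∃ y, T.Adj x y := fun x =>
    hM.isTree.connected.preconnected.exists_adj_of_nontrivial x
  have hbag : ∀ x, ∃ v ∈ D, x ∈ P v := fun x => by
    obtain ⟨y, hxy⟩ := hnb x
    obtain ⟨v, hv, hxv, -⟩ := hD x y hxy
    exact ⟨v, hv, hxv⟩
  have hclique : ∀ (x : X) (u v : D), x ∈ P u → x ∈ P v → (G.induce D).Reachable u v := by
    intro x u v hu hv
    by_cases huv : u = v
    · rw [huv]
    · have hne : (u : V) ≠ v := fun h => huv (Subtype.ext h)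
      exact SimpleGraph.Adj.reachable
        (SimpleGraph.induce_adj.2 ((hM.adj_iff u v hne).2 ⟨x, hu, hv⟩))
  have hreach : ∀ (x y : X), T.Walk x y → ∀ u v : D, x ∈ P u → y ∈ P v →
      (G.induce D).Reachable u v := by
    intro x y p
    induction p with
    | nil => exact hclique _
    | @cons x c y h p ih =>
      intro u v hu hv
      obtain ⟨w, hw, hxw, hcw⟩ := hD x c h
      exact (hclique x u ⟨w, hw⟩ hu hxw).trans (ih ⟨w, hw⟩ v hcw hv)
  have hne : ∀ v, ∃ x, x ∈ P v := fun v => by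
    obtain ⟨a, _, p, -, hp⟩ := hM.isPath v
    exact ⟨a, by rw [hp]; exact p.start_mem_support⟩
  refine ⟨?_, ?_⟩
  · intro v
    obtain ⟨x, hx⟩ := hne v
    obtain ⟨w, hw, hxw⟩ := hbag x
    by_cases hvw : v = w
    · exact Or.inl (hvw ▸ hw)
    · exact Or.inr ⟨w, hw, (hM.adj_iff v w hvw).2 ⟨x, hx, hxw⟩⟩
  · obtain ⟨x⟩ := hX.to_nonempty
    obtain ⟨w, hw, -⟩ := hbag x
    have : Nonempty D := ⟨⟨w, hw⟩⟩
    refine ⟨fun u v => ?_⟩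
    obtain ⟨s, hs⟩ := hne u
    obtain ⟨t, ht⟩ := hne v
    obtain ⟨p⟩ := hM.isTree.connected.preconnected s t
    exact hreach s t p u v hs ht

theorem isMCDS_iff (hX : Nontrivial X) (D : Set V) : IsMCDS G D ↔ IsMinCover T P D := by
  have h : ∀ D, IsConnectedDominating G D ↔ Covers T P D := fun D =>
    ⟨hM.covers_of_isConnectedDominating, hM.isConnectedDominating_of_covers hX⟩
  simp only [IsMCDS, IsMinCover, h]

/-- A cover has two vertices at a junction that cover all its edges and are not twins. -/
theorem exists_pair_of_covers {D : Set V} (hD : Covers T P D) {x : X} (hx : IsTripod T P x) :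
    ∃ u v, u ≠ v ∧ {u, v} ⊆ D ∩ bag P x ∧ ¬ Twins G u v := by
  obtain ⟨y, hxy⟩ : ∃ y, T.Adj x y := by
    obtain ⟨⟨y, z, w, -, -, -, hN⟩, -⟩ := hx
    exact ⟨y, by rw [← SimpleGraph.mem_neighborSet, hN]; simp⟩
  obtain ⟨v, hv, hxv, -⟩ := hD x y hxy
  -- One guest cannot contain all three neighbors. The guest covering a missed edge is the second
  -- vertex, and the missed node rules out twins.
  obtain ⟨z, hxz, hzv⟩ := hM.notMem_of_isTripod hx v
  obtain ⟨u, hu, hxu, hzu⟩ := hD x z hxz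
  refine ⟨u, v, ?_, ?_, hM.not_twins hxz hxv hzu hzv⟩
  · rintro rfl
    exact hzv hzu
  · rintro w (rfl | rfl)
    · exact ⟨hu, hxu⟩
    · exact ⟨hv, hxv⟩

/-- The members of a cover on a terminal path contain the inner vertices of a path of `G` between
the two sides. -/
theorem exists_isPath_of_covers {D : Set V} (hD : Covers T P D) {a b : X} {p : T.Walk a b}
    (hp : IsTerminalPath T P p) {u v : V} (hu : a ∈ P u) (hv : b ∈ P v) :
    ∃ q : G.Walk u v, q.IsPath ∧ innerVerts q ⊆ D ∩ innerBags P p := by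
  classical
  obtain ⟨q, hq⟩ := hM.exists_walk_of_covering p (E := D ∩ innerBags P p) (u := u) (v := v) (by
    intro x y hxy
    obtain ⟨w, hw, hxw, hyw⟩ := hD x y (p.adj_of_mem_edges hxy)
    refine ⟨w, ⟨hw, ?_⟩, hxw, hyw⟩
    rcases inner_of_mem_edges hp.1 hp.2.1 hxy with h | h
    · exact ⟨x, h, hxw⟩
    · exact ⟨y, h, hyw⟩) hu hv
  refine ⟨q.bypass, q.bypass_isPath, ?_⟩
  rintro w ⟨h1, h2, h3⟩
  have := hq w (q.support_bypass_subset_support h1)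
  tauto

theorem ne_of_ends {a b : X} {p : T.Walk a b} (hp : IsTerminalPath T P p) {u v : V}
    (hu : u ∈ bag P a \ bag P p.snd) (hv : v ∈ bag P b \ bag P p.penultimate) : u ≠ v := by
  rintro rfl
  exact hp.ne (eq_start_of_snd_notMem hM.isAcyclic hp.1 (hM.preconnected u) hu.1 hu.2 hv.1
    p.end_mem_support).symm

theorem exists_ends {a b : X} {p : T.Walk a b} (hp : IsTerminalPath T P p) :
    ∃ u v, u ∈ bag P a \ bag P p.snd ∧ v ∈ bag P b \ bag P p.penultimate := by
  have hnil : ¬ p.Nil := by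
    rw [← SimpleGraph.Walk.length_eq_zero_iff]
    have := hp.2.1
    omega
  obtain ⟨u, hu, hu'⟩ := hM.exists_mem_notMem (p.adj_snd hnil).ne
  obtain ⟨v, hv, hv'⟩ := hM.exists_mem_notMem (p.adj_penultimate hnil).ne.symm
  exact ⟨u, v, ⟨hu, hu'⟩, ⟨hv, hv'⟩⟩

/-- Each edge of `T` is at a junction, or joins two terminals, or lies on a terminal path. -/
theorem edge_cases [Finite X] {x y : X} (hxy : T.Adj x y) :
    (IsTripod T P x ∨ IsTripod T P y) ∨ (IsTerminal T P x ∧ IsTerminal T P y) ∨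
      ∃ (a b : X) (p : T.Walk a b), IsTerminalPath T P p ∧ s(x, y) ∈ p.edges := by
  have key : ∀ {x y}, T.Adj x y → ¬ IsTerminal T P x → IsTripod T P x ∨
      ∃ (a b : X) (p : T.Walk a b), IsTerminalPath T P p ∧ s(x, y) ∈ p.edges := by
    intro x y hxy hx
    rcases hM.eq_or_isTripod hx with ⟨c, d, hcd, hN⟩ | h
    · have hdeg : (T.neighborSet x).ncard = 2 := by rw [hN, Set.ncard_pair hcd]
      obtain ⟨a, b, p, hp, hxp⟩ := hM.exists_isTerminalPath hx hdeg
      exact Or.inr ⟨a, b, p, hp, mem_edges_of_inner hp.1 hxp hdeg hxy⟩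
    · exact Or.inl h
  by_cases hx : IsTerminal T P x
  · by_cases hy : IsTerminal T P y
    · exact Or.inr (Or.inl ⟨hx, hy⟩)
    · rcases key hxy.symm hy with h | ⟨a, b, p, hp, h⟩
      · exact Or.inl (Or.inr h)
      · exact Or.inr (Or.inr ⟨a, b, p, hp, by rwa [Sym2.eq_swap]⟩)
  · rcases key hxy hx with h | h
    · exact Or.inl (Or.inl h)
    · exact Or.inr (Or.inr h)

/-! ### The conditions imply minimality -/

theorem isMinCover_of_conditions [Finite V] {D : Set V} (h0 : OnlyListed T P D)
    (h1 : JunctionCondition G T P D) (h2 : TerminalEdgeCondition T P D)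
    (h3 : TerminalPathCondition G T P D) : IsMinCover T P D := by
  have := hM.finite_nodes
  have hpath : ∀ {a b : X} {p : T.Walk a b}, IsTerminalPath T P p → ∀ x y, s(x, y) ∈ p.edges →
      ∃ w ∈ D ∩ innerBags P p, x ∈ P w ∧ y ∈ P w := by
    intro a b p hp x y hxy
    obtain ⟨u, v, hu, hv⟩ := hM.exists_ends hp
    obtain ⟨q, -, hq⟩ := h3 a b p hp u hu v hv
    rw [← hq]
    exact hM.exists_innerVerts_covering hp.1 hu hv q hxy
  have hjun : ∀ {x y}, IsTripod T P x → T.Adj x y → ∃ w ∈ D ∩ bag P x, x ∈ P w ∧ y ∈ P w := by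
    intro x y hx hxy
    obtain ⟨u, v, -, heq, hN, -⟩ := h1 x (hM.isJunction_of_isTripod hx)
    have hu : u ∈ D ∩ bag P x := by rw [heq]; simp
    have hv : v ∈ D ∩ bag P x := by rw [heq]; simp
    rcases hN hxy with h | h
    · exact ⟨u, hu, hu.2, h⟩
    · exact ⟨v, hv, hv.2, h⟩
  have hcov : Covers T P D := by
    intro x y hxy
    rcases hM.edge_cases hxy with (h | h) | ⟨hx, hy⟩ | ⟨a, b, p, hp, h⟩
    · obtain ⟨w, hw, h'⟩ := hjun h hxy
      exact ⟨w, hw.1, h'⟩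
    · obtain ⟨w, hw, h', h''⟩ := hjun h hxy.symm
      exact ⟨w, hw.1, h'', h'⟩
    · obtain ⟨w, hw, -⟩ := h2 x y hxy hx hy
      exact ⟨w, hw.1, hw.2⟩
    · obtain ⟨w, hw, h'⟩ := hpath hp x y h
      exact ⟨w, hw.1, h'⟩
  refine hcov.isMinCover fun v hv => ?_
  rcases h0 v hv with ⟨x, hx, hvx⟩ | ⟨x, y, hxy, hx, hy, hvxy⟩ | ⟨a, b, p, hp, hvp⟩
  · have htri := hM.isTripod_of_isJunction hx
    refine ⟨bag P x, hvx, ?_, fun D' hD' => ?_⟩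
    · rintro c d hcd ⟨w, hxw, hcw, hdw⟩
      rcases hM.eq_of_adj_of_isTripod htri hxw hcw hdw hcd with rfl | rfl
      · exact hjun htri hcd
      · obtain ⟨w', h4, h5, h6⟩ := hjun htri hcd.symm
        exact ⟨w', h4, h6, h5⟩
    · obtain ⟨u, v, -, heq, -⟩ := h1 x hx
      obtain ⟨u', v', hne, hsub, -⟩ := hM.exists_pair_of_covers hD' htri
      rw [heq]
      calc ({u, v} : Set V).ncard ≤ 2 := Set.ncard_insert_le u {v} |>.trans (by simp)
        _ = ({u', v'} : Set V).ncard := (Set.ncard_pair hne).symm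
        _ ≤ _ := Set.ncard_le_ncard hsub
  · refine ⟨bag P x ∩ bag P y, hvxy, ?_, fun D' hD' => ?_⟩
    · rintro c d hcd ⟨w, ⟨hxw, hyw⟩, hcw, hdw⟩
      have hc := hM.subset_pair_of_isTerminal hx hy hxy hxw hyw hcw
      have hd := hM.subset_pair_of_isTerminal hx hy hxy hxw hyw hdw
      refine ⟨v, ⟨hv, hvxy⟩, ?_, ?_⟩
      · rcases hc with rfl | rfl
        · exact hvxy.1
        · exact hvxy.2
      · rcases hd with rfl | rfl
        · exact hvxy.1
        · exact hvxy.2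
    · obtain ⟨w, hw, huniq⟩ := h2 x y hxy hx hy
      obtain ⟨w', hw', h'⟩ := hD' x y hxy
      calc (D ∩ (bag P x ∩ bag P y)).ncard ≤ ({w} : Set V).ncard :=
            Set.ncard_le_ncard fun t ht => huniq t ht
        _ = ({w'} : Set V).ncard := by simp
        _ ≤ _ := Set.ncard_le_ncard (by rintro t rfl; exact ⟨hw', h'⟩)
  · refine ⟨innerBags P p, hvp, ?_, fun D' hD' => ?_⟩
    · rintro c d hcd ⟨w, hw, hcw, hdw⟩
      exact hpath hp c d (hM.mem_edges_of_innerBags hp hw hcw hdw hcd)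
    · obtain ⟨u, v, hu, hv⟩ := hM.exists_ends hp
      have huv := hM.ne_of_ends hp hu hv
      obtain ⟨q, ⟨hq1, hq2⟩, hq3⟩ := h3 a b p hp u hu v hv
      obtain ⟨q', hq1', hq2'⟩ := hM.exists_isPath_of_covers hD' hp hu.1 hv.1
      -- On this block `D'` contains the inner vertices of some `(u,v)`-path, and `D` has only those
      -- of a shortest one.
      have h4 := SimpleGraph.dist_le q'
      have h5 := Set.ncard_le_ncard hq2'
      rw [ncard_innerVerts hq1' huv] at h5
      rw [← hq3, ncard_innerVerts hq1 huv]
      omega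

/-! ### Minimality implies the conditions -/

theorem onlyListed_of_isMinCover [Finite V] {D : Set V} (hD : IsMinCover T P D) :
    OnlyListed T P D := by
  have := hM.finite_nodes
  intro v hv
  -- A vertex covering no edge could be dropped: exchange `{v}` for the empty set.
  obtain ⟨x, y, hxy, hxv, hyv⟩ : ∃ x y, T.Adj x y ∧ x ∈ P v ∧ y ∈ P v := by
    by_contra! hc
    have h := hD.ncard_inter_le (S := {v}) (E := ∅) (by
      rintro x y hxy ⟨w, rfl, hxw, hyw⟩
      exact absurd hyw (hc x y hxy hxw))
    rw [Set.inter_eq_right.2 (by simpa using hv)] at h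
    simp at h
  rcases hM.edge_cases hxy with (h | h) | ⟨hx, hy⟩ | ⟨a, b, p, hp, h⟩
  · exact Or.inl ⟨x, hM.isJunction_of_isTripod h, hxv⟩
  · exact Or.inl ⟨y, hM.isJunction_of_isTripod h, hyv⟩
  · exact Or.inr (Or.inl ⟨x, y, hxy, hx, hy, hxv, hyv⟩)
  · refine Or.inr (Or.inr ⟨a, b, p, hp, ?_⟩)
    rcases inner_of_mem_edges hp.1 hp.2.1 h with h | h
    · exact ⟨x, h, hxv⟩
    · exact ⟨y, h, hyv⟩

theorem junctionCondition_of_isMinCover [Finite V] {D : Set V} (hD : IsMinCover T P D) :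
    JunctionCondition G T P D := by
  intro x hx
  have htri := hM.isTripod_of_isJunction hx
  obtain ⟨u, v, hne, hsub, htw⟩ := hM.exists_pair_of_covers hD.1 htri
  obtain ⟨u', v', hxu', hxv', hN⟩ := htri.exists_two
  have hle := hD.ncard_inter_le (S := bag P x) (E := {u', v'}) (by
    rintro c d hcd ⟨w, hxw, hcw, hdw⟩
    rcases hM.eq_of_adj_of_isTripod htri hxw hcw hdw hcd with rfl | rfl
    · rcases hN d hcd with h | h
      · exact ⟨u', by simp, hxu', h⟩
      · exact ⟨v', by simp, hxv', h⟩
    · rcases hN c hcd.symm with h | h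
      · exact ⟨u', by simp, h, hxu'⟩
      · exact ⟨v', by simp, h, hxv'⟩)
  have hle2 : ({u', v'} : Set V).ncard ≤ 2 := Set.ncard_insert_le u' {v'} |>.trans (by simp)
  have heq : {u, v} = D ∩ bag P x :=
    Set.eq_of_subset_of_ncard_le hsub (by rw [Set.ncard_pair hne]; omega)
  refine ⟨u, v, hne, heq.symm, fun y hy => ?_, htw⟩
  obtain ⟨w, hw, hxw, hyw⟩ := hD.1 x y hy
  have : w ∈ ({u, v} : Set V) := heq ▸ ⟨hw, hxw⟩
  rcases this with rfl | rfl
  · exact Or.inl hyw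
  · exact Or.inr hyw

theorem terminalEdgeCondition_of_isMinCover [Finite V] {D : Set V} (hD : IsMinCover T P D) :
    TerminalEdgeCondition T P D := by
  intro x y hxy hx hy
  obtain ⟨v, hv, hxv, hyv⟩ := hD.1 x y hxy
  have hle := hD.ncard_inter_le (S := bag P x ∩ bag P y) (E := {v}) (by
    rintro c d hcd ⟨w, ⟨hxw, hyw⟩, hcw, hdw⟩
    have hsub := hM.subset_pair_of_isTerminal hx hy hxy hxw hyw
    refine ⟨v, rfl, ?_, ?_⟩
    · rcases hsub hcw with rfl | rfl <;> assumption
    · rcases hsub hdw with rfl | rfl <;> assumption)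
  rw [Set.ncard_singleton, Set.ncard_le_one_iff] at hle
  exact ⟨v, ⟨hv, hxv, hyv⟩, fun w hw => hle hw ⟨hv, hxv, hyv⟩⟩

/-- The part of `D` on the block contains the inner vertices of a path `q`, and exchanging it for
those of a shortest path `r` shows that it has no more than `r` has. Hence `q` is shortest and
exhausts that part. -/
theorem terminalPathCondition_of_isMinCover [Finite V] (hconn : G.Connected) {D : Set V}
    (hD : IsMinCover T P D) : TerminalPathCondition G T P D := by
  intro a b p hp u hu v hv
  have huv := hM.ne_of_ends hp hu hv
  obtain ⟨q, hq1, hq2⟩ := hM.exists_isPath_of_covers hD.1 hp hu.1 hv.1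
  obtain ⟨r, hr1, hr2⟩ := hconn.exists_path_of_dist u v
  have h1 := hD.ncard_inter_le (S := innerBags P p) (E := innerVerts r) (by
    rintro c d hcd ⟨w, hw, hcw, hdw⟩
    exact hM.exists_innerVerts_covering hp.1 hu hv r
      (hM.mem_edges_of_innerBags hp hw hcw hdw hcd))
  have h2 := Set.ncard_le_ncard hq2
  have h3 := SimpleGraph.dist_le q
  -- Positive distance keeps the truncated subtraction in the count of inner vertices exact.
  have h4 := hconn.pos_dist_of_ne huv
  rw [ncard_innerVerts hr1 huv] at h1
  rw [ncard_innerVerts hq1 huv] at h2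
  refine ⟨q, ⟨hq1, by omega⟩, Set.eq_of_subset_of_ncard_le hq2 ?_⟩
  rw [ncard_innerVerts hq1 huv]
  omega

end IsCliqueNCPathTreeModel

end Covers

end NCPathTree

theorem mainTheorem5 {V X : Type*} [Finite V] (G : SimpleGraph V) (hconn : G.Connected)
    (hG : G ≠ ⊤) (T : SimpleGraph X) (P : V → Set X)
    (hmodel : NCPathTree.IsCliqueNCPathTreeModel G T P) (D : Set V) :
    NCPathTree.IsMCDS G D ↔
      NCPathTree.OnlyListed T P D ∧
      NCPathTree.JunctionCondition G T P D ∧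
      NCPathTree.TerminalEdgeCondition T P D ∧
      NCPathTree.TerminalPathCondition G T P D := by
  rw [hmodel.isMCDS_iff (hmodel.nontrivial_nodes hG)]
  exact ⟨fun h => ⟨hmodel.onlyListed_of_isMinCover h, hmodel.junctionCondition_of_isMinCover h,
    hmodel.terminalEdgeCondition_of_isMinCover h,
    hmodel.terminalPathCondition_of_isMinCover hconn h⟩,
    fun h => hmodel.isMinCover_of_conditions h.1 h.2.1 h.2.2.1 h.2.2.2⟩
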